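/- **Proposition 4.1 (Non-positive curvature implies Ptolemaic).** A *Lorentzian pre-length space* $(X,\mathsf d,\ll,\le,\ell)$ is a metric space $(X,\mathsf d)$ with a reflexive and transitive relation $\le$, a transitive relation $\ll$ contained in $\le$, and a function $\ell:X\times X\to[0,+\infty]$ such that $\ell(x,z)\ge\ell(x,y)+\ell(y,z)$ whenever $x\le y\le z$, and $\ell(x,y)>0$ if and only if $x\ll y$. A *maximising geodesic* from $x$ to $y$ is a non-constant Lipschitz curve $\gamma:[0,1]\to X$ from $x$ to $y$ with $\gamma(s)\le\gamma(t)$ for $s<t$, whose $\ell$-length (the infimum of $\sum_i\ell(\gamma(t_i),\gamma(t_{i+1}))$ over all partitions $0=t_0<\dots<t_n=1$) equals $\ell(x,y)$. A *timelike triangle* consists of points $x\ll y\ll z$ with $\ell(x,z)<\infty$ and of three maximising geodesics, from $x$ to $y$, from $y$ to $z$ and from $x$ to $z$, called its sides. A *comparison triangle* is a triple $\bar x,\bar y,\bar z$ in the Minkowski plane $\mathbb R^{1,1}$ with the same time separations, its sides being the straight segments; the *comparison point* of a point $p$ on a side is the point $\bar p$ on the corresponding segment with the same time separations from and to the endpoints.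 $X$ has *timelike curvature globally bounded above by $0$* (is *globally non-positively curved*) if 1. $\ell:X\times X\to[0,+\infty]$ is continuous; 2. any two points $x\ll y$ with $\ell(x,y)<\infty$ are joined by a maximising geodesic; 3. for every timelike triangle in $X$, every comparison triangle of it in $\mathbb R^{1,1}$, and all points $p,q$ on the sides with comparison points $\bar p,\bar q$, one has $\ell(p,q)\ge\ell(\bar p,\bar q)$, where the time separation $\ell(\bar p,\bar q)$ in $\mathbb R^{1,1}$ is $\sqrt{(\Delta t)^2-(\Delta s)^2}$ if $\bar q-\bar p=(\Delta t,\Delta s)$ satisfies $\Delta t\ge|\Delta s|$, and $0$ otherwise. *Claim.* Every Lorentzian pre-length space $X$ with timelike curvature globally bounded above by $0$ is Ptolemaic, that is, for all points $x\le y\le z\le w$ in $X$, $$\ell(x,z)\,\ell(y,w)\ \ge\ \ell(x,y)\,\ell(z,w)+\ell(x,w)\,\ell(y,z)$$ (with the convention $0\cdot\infty=0$). -/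

import Mathlib

open scoped ENNReal

/-- A Lorentzian pre-length space structure on a metric space `X`: causal relation `le`,
chronological relation `ll`, and time separation function `ell` with values in `[0, +∞]`. -/
structure LorentzianPreLengthSpace (X : Type*) [MetricSpace X] where
  le : X → X → Prop
  ll : X → X → Prop
  ell : X → X → ℝ≥0∞
  le_refl : ∀ x, le x x
  le_trans : ∀ x y z, le x y → le y z → le x z
  ll_trans : ∀ x y z, ll x y → ll y z → ll x z
  le_of_ll : ∀ x y, ll x y → le x y
  reverse_triangle : ∀ x y z, le x y → le y z → ell x y + ell y z ≤ ell x z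
  ell_pos_iff : ∀ x y, 0 < ell x y ↔ ll x y

/-- The time separation function of the Minkowski plane `ℝ^{1,1}`; the first coordinate is time. -/
noncomputable def minkowskiEll (p q : ℝ × ℝ) : ℝ≥0∞ :=
  if |q.2 - p.2| ≤ q.1 - p.1 then
    ENNReal.ofReal (Real.sqrt ((q.1 - p.1) ^ 2 - (q.2 - p.2) ^ 2))
  else 0

namespace LorentzianPreLengthSpace

variable {X : Type*} [MetricSpace X] (L : LorentzianPreLengthSpace X)

/-- The Ptolemy inequality for all causally ordered quadruples. -/
def IsPtolemaic : Prop :=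
  ∀ x y z w : X, L.le x y → L.le y z → L.le z w →
    L.ell x y * L.ell z w + L.ell x w * L.ell y z ≤ L.ell x z * L.ell y w

/-- The `ℓ`-length of a curve on `[0, 1]`: the infimum of the sums of time separations over all
partitions `0 = t 0 < t 1 < ... < t n = 1`. -/
noncomputable def length (γ : ℝ → X) : ℝ≥0∞ :=
  ⨅ (n : ℕ) (t : ℕ → ℝ) (_ : t 0 = 0 ∧ t n = 1 ∧ ∀ i < n, t i < t (i + 1)),
    ∑ i ∈ Finset.range n, L.ell (γ (t i)) (γ (t (i + 1)))

/-- `γ`, restricted to `[0, 1]`, is a future-directed causal curve from `x` to `y`: a nonconstant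
Lipschitz curve whose points are causally ordered. -/
structure IsCausalCurve (γ : ℝ → X) (x y : X) : Prop where
  source : γ 0 = x
  target : γ 1 = y
  lipschitz : ∃ C, LipschitzOnWith C γ (Set.Icc 0 1)
  nonconstant : ∃ s ∈ Set.Icc (0 : ℝ) 1, ∃ t ∈ Set.Icc (0 : ℝ) 1, γ s ≠ γ t
  causal : ∀ s ∈ Set.Icc (0 : ℝ) 1, ∀ t ∈ Set.Icc (0 : ℝ) 1, s < t → L.le (γ s) (γ t)

/-- `γ` is a maximising geodesic from `x` to `y` inside `U`: a causal curve in `U` whose length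
equals the time separation of its endpoints. -/
structure IsMaximisingGeodesic (U : Set X) (γ : ℝ → X) (x y : X) : Prop
    extends L.IsCausalCurve γ x y where
  inside : ∀ t ∈ Set.Icc (0 : ℝ) 1, γ t ∈ U
  maximising : L.length γ = L.ell x y

/-- A timelike triangle in `U`: vertices `x ≪ y ≪ z` with `ℓ(x, z) < ∞`, and sides given by
maximising geodesics `α` from `x` to `y`, `β` from `y` to `z`, and `γ` from `x` to `z`. -/
structure IsTimelikeTriangle (U : Set X) (x y z : X) (α β γ : ℝ → X) : Prop where
  ll_xy : L.ll x y
  ll_yz : L.ll y z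
  ell_lt_top : L.ell x z < ⊤
  side_xy : L.IsMaximisingGeodesic U α x y
  side_yz : L.IsMaximisingGeodesic U β y z
  side_xz : L.IsMaximisingGeodesic U γ x z

/-- `x' y' z'` are the vertices of a comparison triangle in the Minkowski plane. -/
def IsComparisonTriangle (x y z : X) (x' y' z' : ℝ × ℝ) : Prop :=
  minkowskiEll x' y' = L.ell x y ∧ minkowskiEll y' z' = L.ell y z ∧
    minkowskiEll x' z' = L.ell x z

/-- `p` lies on the side `γ` from `a` to `b`, and `p'` is the comparison point for `p` on the
corresponding side, the straight segment from `a'` to `b'` in the Minkowski plane. -/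
def IsComparisonPoint (γ : ℝ → X) (a b : X) (a' b' : ℝ × ℝ) (p : X) (p' : ℝ × ℝ) : Prop :=
  p ∈ γ '' Set.Icc 0 1 ∧ p' ∈ segment ℝ a' b' ∧
    minkowskiEll a' p' = L.ell a p ∧ minkowskiEll p' b' = L.ell p b

/-- `p` lies on some side of the triangle with vertices `x, y, z` and sides `α, β, γ`, and `p'` is
the comparison point for `p` on the corresponding side of the comparison triangle. -/
def IsTriangleComparisonPoint (x y z : X) (α β γ : ℝ → X) (x' y' z' : ℝ × ℝ)
    (p : X) (p' : ℝ × ℝ) : Prop :=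
  L.IsComparisonPoint α x y x' y' p p' ∨ L.IsComparisonPoint β y z y' z' p p' ∨
    L.IsComparisonPoint γ x z x' z' p p'

/-- `U` is a `(≤ 0)`-comparison neighbourhood in the sense of triangle comparison. The model space
of curvature `0` is the Minkowski plane and has `D_0 = +∞`, so that the set
`(U × U) ∩ ℓ⁻¹([0, D_0])` on which `ℓ` is required to be continuous is `U × U`; it is open since
`U` is. -/
structure IsNonposComparisonNeighbourhood (U : Set X) : Prop where
  isOpen : IsOpen U
  continuousOn : ContinuousOn (fun p : X × X => L.ell p.1 p.2) (U ×ˢ U)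
  exists_geodesic : ∀ x ∈ U, ∀ y ∈ U, L.ll x y → L.ell x y < ⊤ →
    ∃ γ, L.IsMaximisingGeodesic U γ x y
  comparison : ∀ (x y z : X) (α β γ : ℝ → X), L.IsTimelikeTriangle U x y z α β γ →
    ∀ x' y' z' : ℝ × ℝ, L.IsComparisonTriangle x y z x' y' z' →
    ∀ (p q : X) (p' q' : ℝ × ℝ),
      L.IsTriangleComparisonPoint x y z α β γ x' y' z' p p' →
      L.IsTriangleComparisonPoint x y z α β γ x' y' z' q q' →
      minkowskiEll p' q' ≤ L.ell p q

/-- Timelike curvature globally bounded above by `0`: the whole space is a `(≤ 0)`-comparison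
neighbourhood. -/
def GloballyNonpositivelyCurved : Prop :=
  L.IsNonposComparisonNeighbourhood Set.univ

end LorentzianPreLengthSpace

/-! For a chain `x ≪ y ≪ z ≪ w` with finite separations, place comparison triangles for `x y z` and
`x z w` on opposite sides of a common segment `x'z'` of the time axis. If the quadrilateral is
convex at `z'`, the segment `y'w'` meets `x'z'`, and comparison in both triangles at the crossing
point gives `ℓ(y,w) ≥ ℓ(y',w')` (`minkowskiEll_add_le_ell`). The claim then follows from the planar
inequality `minkowski_ptolemy`. Otherwise the bound `ℓ(y,w) ≥ ℓ(y,z) + ℓ(z,w)` already suffices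
(`ptolemy_of_stewart`).

Merely causal ends are handled by moving `y` and `z` slightly inward along geodesics; infinite
separations by a contradiction from continuity of `ℓ`. -/

/-! ### Real inequalities for Minkowski quadrilaterals -/

/-- If `A = A₁ + A₂` and `B = B₁ + B₂`, then `√(A₁ B₁) + √(A₂ B₂) ≤ √(A B)`, stated for squares. -/
theorem add_sq_le_mul_of_sq_eq {A₁ A₂ B₁ B₂ p q : ℝ} (hA₁ : 0 ≤ A₁) (hA₂ : 0 ≤ A₂)
    (hB₁ : 0 ≤ B₁) (hB₂ : 0 ≤ B₂) (hp : p ^ 2 = A₁ * B₁) (hq : q ^ 2 = A₂ * B₂) :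
    (p + q) ^ 2 ≤ (A₁ + A₂) * (B₁ + B₂) := by
  have h : 2 * (p * q) ≤ A₁ * B₂ + A₂ * B₁ := by
    refine le_of_abs_le (abs_le_of_sq_le_sq ?_ (by positivity))
    have : (2 * (p * q)) ^ 2 = 4 * ((A₁ * B₂) * (A₂ * B₁)) := by
      calc (2 * (p * q)) ^ 2 = 4 * (p ^ 2 * q ^ 2) := by ring
        _ = _ := by rw [hp, hq]; ring
    rw [this]
    nlinarith [sq_nonneg (A₁ * B₂ - A₂ * B₁)]
  nlinarith

/-- The Ptolemy inequality in the Minkowski plane, for the points `(0, 0)`, `(y, -m)`, `(e, 0)`,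
`(w, n)`. -/
theorem minkowski_ptolemy {a b c d e m n y w : ℝ}
    (he : 0 ≤ e) (hm : 0 ≤ m) (hn : 0 ≤ n) (hmy : m ≤ y) (hme : m ≤ e - y) (hnw : n ≤ w - e)
    (h₁ : a ^ 2 = y ^ 2 - m ^ 2) (h₂ : b ^ 2 = (e - y) ^ 2 - m ^ 2)
    (h₃ : c ^ 2 = (w - e) ^ 2 - n ^ 2) (h₄ : d ^ 2 = w ^ 2 - n ^ 2) :
    a * c + d * b ≤ e * √((w - y) ^ 2 - (n + m) ^ 2) := by
  -- In null coordinates `t - s` and `t + s` a squared separation is a product of differences. The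
  -- `A`s and `B`s are the two sides' terms of the identity `(y-x)(w-z) + (w-x)(z-y) = (z-x)(w-y)`
  -- in each coordinate.
  have key := add_sq_le_mul_of_sq_eq (A₁ := (y + m) * (w - n - e)) (A₂ := (w - n) * (e - y - m))
    (B₁ := (y - m) * (w + n - e)) (B₂ := (w + n) * (e - y + m)) (p := a * c) (q := d * b)
    (mul_nonneg (by linarith) (by linarith)) (mul_nonneg (by linarith) (by linarith))
    (mul_nonneg (by linarith) (by linarith)) (mul_nonneg (by linarith) (by linarith))
    (by rw [mul_pow, h₁, h₃]; ring) (by rw [mul_pow, h₄, h₂]; ring)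
  have : e * √((w - y) ^ 2 - (n + m) ^ 2) = √(e ^ 2 * ((w - y) ^ 2 - (n + m) ^ 2)) := by
    rw [Real.sqrt_mul (sq_nonneg e), Real.sqrt_sq he]
  rw [this]
  exact Real.le_sqrt_of_sq_le (key.trans (le_of_eq (by ring)))

/-- The Ptolemy inequality when the comparison quadrilateral is not convex at `z`. -/
theorem ptolemy_of_stewart {a b c d e f : ℝ} (hb : 0 < b) (hc : 0 < c) (he : 0 < e)
    (hf : b + c ≤ f) (hd : a + b + c ≤ d)
    (h : b * d ^ 2 + c * a ^ 2 ≤ (b + c) * (e ^ 2 + b * c)) :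
    a * c + d * b ≤ e * f := by
  have h₁ : a * c + d * b ≤ e * (b + c) := by
    refine le_of_abs_le (abs_le_of_sq_le_sq ?_ (by positivity))
    -- The identity used is `(ac + db)² = (b+c)(bd² + ca²) - bc(d-a)²`.
    have h₂ : (b + c) ^ 2 ≤ (d - a) ^ 2 := by
      apply pow_le_pow_left₀ <;> linarith
    have h₃ := mul_le_mul_of_nonneg_left h₂ (mul_pos hb hc).le
    have h₄ := mul_le_mul_of_nonneg_left h (add_pos hb hc).le
    nlinarith
  exact h₁.trans (mul_le_mul_of_nonneg_left hf he.le)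

theorem lt_of_sq_eq_sub {a m y : ℝ} (ha : 0 < a) (hy : 0 ≤ y) (h : a ^ 2 = y ^ 2 - m ^ 2) :
    m < y :=
  lt_of_pow_lt_pow_left₀ 2 hy (by linarith [pow_pos ha 2])

/-- The apex of a Minkowski triangle whose longest side has length `e`. -/
theorem exists_apex_between {a b e : ℝ} (ha : 0 < a) (hb : 0 < b) (h : a + b ≤ e) :
    ∃ y m, 0 ≤ m ∧ a ≤ y ∧ b ≤ e - y ∧ a ^ 2 = y ^ 2 - m ^ 2 ∧
      b ^ 2 = (e - y) ^ 2 - m ^ 2 := by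
  have he : 0 < e := by linarith
  -- Subtracting the two equations for `a ^ 2` and `b ^ 2` eliminates `m` and is linear in `y`.
  obtain ⟨y, hy⟩ : ∃ y, y = (e ^ 2 + a ^ 2 - b ^ 2) / (2 * e) := ⟨_, rfl⟩
  have hy' : 2 * e * y = e ^ 2 + a ^ 2 - b ^ 2 := by rw [hy]; field_simp
  have hay : a ≤ y := by
    rw [hy, le_div_iff₀ (by positivity)]; nlinarith
  have hby : b ≤ e - y := by
    rw [le_sub_comm, hy, div_le_iff₀ (by positivity)]; nlinarith
  have hm : √(y ^ 2 - a ^ 2) ^ 2 = y ^ 2 - a ^ 2 := Real.sq_sqrt (by nlinarith)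
  exact ⟨y, _, Real.sqrt_nonneg _, hay, hby, by linarith, by linarith⟩

/-- The last vertex of a Minkowski triangle whose first side has length `e`. -/
theorem exists_apex_beyond {c d e : ℝ} (he : 0 < e) (hc : 0 < c) (h : e + c ≤ d) :
    ∃ w n, 0 ≤ n ∧ d ≤ w ∧ c ≤ w - e ∧ d ^ 2 = w ^ 2 - n ^ 2 ∧
      c ^ 2 = (w - e) ^ 2 - n ^ 2 := by
  obtain ⟨w, hw⟩ : ∃ w, w = (d ^ 2 + e ^ 2 - c ^ 2) / (2 * e) := ⟨_, rfl⟩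
  have hw' : 2 * e * w = d ^ 2 + e ^ 2 - c ^ 2 := by rw [hw]; field_simp
  have hcw : c ≤ w - e := by
    rw [le_sub_iff_add_le, hw, le_div_iff₀ (by positivity)]; nlinarith
  have hdw : d ≤ w := by
    rw [hw, le_div_iff₀ (by positivity)]; nlinarith
  have hn : √(w ^ 2 - d ^ 2) ^ 2 = w ^ 2 - d ^ 2 := Real.sq_sqrt (by nlinarith)
  exact ⟨w, _, Real.sqrt_nonneg _, hdw, hcw, by linarith, by linarith⟩

/-- If `f` dominates the length of every broken line from `(y, -m)` to `(w, n)` with a single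
break on the time axis between the times `0` and `e`, then the Ptolemy inequality holds provided
that the comparison quadrilateral is convex at `(e, 0)`. -/
theorem ptolemy_of_broken_lines {a b c d e f m n y w : ℝ}
    (ha : 0 < a) (hb : 0 < b) (hc : 0 < c) (he : 0 < e)
    (hm : 0 ≤ m) (hn : 0 ≤ n) (hay : a ≤ y) (hby : b ≤ e - y) (hcw : c ≤ w - e)
    (h₁ : a ^ 2 = y ^ 2 - m ^ 2) (h₂ : b ^ 2 = (e - y) ^ 2 - m ^ 2)
    (h₃ : c ^ 2 = (w - e) ^ 2 - n ^ 2) (h₄ : d ^ 2 = w ^ 2 - n ^ 2)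
    (hconv : c * (e - y) ≤ b * (w - e))
    (hf : ∀ P, 0 ≤ P → P ≤ e → m < P - y →
      √((P - y) ^ 2 - m ^ 2) + √((w - P) ^ 2 - n ^ 2) ≤ f) :
    a * c + d * b ≤ e * f := by
  have hmy : m < y := lt_of_sq_eq_sub ha (by linarith) h₁
  have hme : m < e - y := lt_of_sq_eq_sub hb (by linarith) h₂
  have hnw : n < w - e := lt_of_sq_eq_sub hc (by linarith) h₃
  refine (minkowski_ptolemy he.le hm hn hmy.le hme.le hnw.le h₁ h₂ h₃ h₄).trans
    (mul_le_mul_of_nonneg_left ?_ he.le)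
  rcases hm.eq_or_lt with rfl | hm
  -- Here `(y, -m)` lies on the axis and is itself the crossing point; `hf` needs `P > y`, so `P`
  -- tends to `y` from the right.
  · have hlim : Filter.Tendsto (fun P : ℝ => √((P - y) ^ 2 - 0 ^ 2) + √((w - P) ^ 2 - n ^ 2))
        (nhdsWithin y (Set.Ioi y)) (nhds (√((y - y) ^ 2 - 0 ^ 2) + √((w - y) ^ 2 - n ^ 2))) := by
      have : Continuous (fun P : ℝ => √((P - y) ^ 2 - 0 ^ 2) + √((w - P) ^ 2 - n ^ 2)) := by
        fun_prop
      exact this.continuousWithinAt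
    have := le_of_tendsto hlim (b := f) (by
      filter_upwards [Ioc_mem_nhdsGT (show y < e by linarith)] with P hP
      exact hf P (by linarith [hP.1]) hP.2 (by linarith [hP.1]))
    simpa using this
  · have hnm : 0 < n + m := by linarith
    -- The segment from `(y, -m)` to `(w, n)` crosses the axis at parameter `τ`, which divides its
    -- length in the ratio `τ : 1 - τ`.
    obtain ⟨τ, hτ⟩ : ∃ τ, τ = m / (n + m) := ⟨_, rfl⟩
    have hτm : τ * (n + m) = m := by rw [hτ]; field_simp
    have hτ0 : 0 < τ := by rw [hτ]; positivity
    have hτ1 : τ ≤ 1 := by rw [hτ, div_le_one hnm]; linarith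
    -- Convexity rewritten with slopes: the crossing occurs no later than time `e`.
    have hcross : m * (w - e) ≤ n * (e - y) := by
      refine le_of_abs_le (abs_le_of_sq_le_sq ?_ (mul_nonneg hn (by linarith)))
      have h₅ : (c * (e - y)) ^ 2 ≤ (b * (w - e)) ^ 2 :=
        pow_le_pow_left₀ (mul_nonneg hc.le (by linarith)) hconv 2
      have hm2 : m ^ 2 = (e - y) ^ 2 - b ^ 2 := by linarith
      have hn2 : n ^ 2 = (w - e) ^ 2 - c ^ 2 := by linarith
      rw [mul_pow, mul_pow, hm2, hn2]
      nlinarith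
    have hP := hf (y + τ * (w - y)) (by nlinarith) ?_ ?_
    · have e₁ : (y + τ * (w - y) - y) ^ 2 - m ^ 2
          = τ ^ 2 * ((w - y) ^ 2 - (n + m) ^ 2) := by
        linear_combination (τ * (n + m) + m) * hτm
      have e₂ : (w - (y + τ * (w - y))) ^ 2 - n ^ 2
          = (1 - τ) ^ 2 * ((w - y) ^ 2 - (n + m) ^ 2) := by
        linear_combination ((1 - τ) * (n + m) + n) * (-hτm)
      rw [e₁, e₂, Real.sqrt_mul (sq_nonneg _), Real.sqrt_mul (sq_nonneg _), Real.sqrt_sq hτ0.le,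
        Real.sqrt_sq (by linarith)] at hP
      linarith
    · have : τ * (w - y) ≤ e - y := by
        rw [hτ, div_mul_eq_mul_div, div_le_iff₀ hnm]
        nlinarith
      linarith
    · have : τ * (n + m) < τ * (w - y) := mul_lt_mul_of_pos_left (by linarith) hτ0
      linarith

theorem minkowskiEll_of_abs_le {p q : ℝ × ℝ} {r : ℝ} (hr : 0 ≤ r)
    (h : |q.2 - p.2| ≤ q.1 - p.1) (h' : r ^ 2 = (q.1 - p.1) ^ 2 - (q.2 - p.2) ^ 2) :
    minkowskiEll p q = ENNReal.ofReal r := by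
  rw [minkowskiEll, if_pos h, ← h', Real.sqrt_sq hr]

theorem minkowskiEll_self (p : ℝ × ℝ) : minkowskiEll p p = 0 := by
  simp [minkowskiEll]

/-! ### Time separation along maximising geodesics -/

namespace LorentzianPreLengthSpace

variable {X : Type*} [MetricSpace X] {L : LorentzianPreLengthSpace X}

/-- Finiteness is what allows cancellation in the reverse triangle inequality. This makes a vertex
its own comparison point. -/
theorem ell_self_right {x y : X} (hxy : L.le x y) (h : L.ell x y ≠ ⊤) : L.ell y y = 0 := by
  have := L.reverse_triangle x y y hxy (L.le_refl y)
  exact nonpos_iff_eq_zero.1 (ENNReal.le_of_add_le_add_left h (by simpa using this))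

theorem ell_self_left {x y : X} (hxy : L.le x y) (h : L.ell x y ≠ ⊤) : L.ell x x = 0 := by
  have := L.reverse_triangle x x y (L.le_refl x) hxy
  exact nonpos_iff_eq_zero.1 (ENNReal.le_of_add_le_add_right h (by simpa using this))

theorem ell_le_left {x y z : X} (hxy : L.le x y) (hyz : L.le y z) : L.ell x y ≤ L.ell x z :=
  le_self_add.trans (L.reverse_triangle x y z hxy hyz)

theorem ell_le_right {x y z : X} (hxy : L.le x y) (hyz : L.le y z) : L.ell y z ≤ L.ell x z :=
  le_add_self.trans (L.reverse_triangle x y z hxy hyz)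

theorem length_le_add (L : LorentzianPreLengthSpace X) (γ : ℝ → X) {t : ℝ} (h₀ : 0 < t)
    (h₁ : t < 1) : L.length γ ≤ L.ell (γ 0) (γ t) + L.ell (γ t) (γ 1) := by
  let τ : ℕ → ℝ := fun i => if i = 0 then 0 else if i = 1 then t else 1
  have hτ : τ 0 = 0 ∧ τ 2 = 1 ∧ ∀ i < 2, τ i < τ (i + 1) := by
    refine ⟨by simp [τ], by simp [τ], fun i hi => ?_⟩
    interval_cases i <;> simp [τ, h₀, h₁]
  refine (iInf₂_le_of_le 2 τ (iInf_le_of_le hτ le_rfl)).trans ?_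
  simp [τ, Finset.sum_range_succ]

namespace IsMaximisingGeodesic

variable {U : Set X} {γ : ℝ → X} {x y : X}

theorem le_source (h : L.IsMaximisingGeodesic U γ x y) {t : ℝ} (ht : t ∈ Set.Icc (0 : ℝ) 1) :
    L.le x (γ t) := by
  rcases ht.1.eq_or_lt with rfl | h₀
  · rw [h.source]; exact L.le_refl x
  · simpa [h.source] using h.causal 0 (by simp) t ht h₀

theorem le_target (h : L.IsMaximisingGeodesic U γ x y) {t : ℝ} (ht : t ∈ Set.Icc (0 : ℝ) 1) :
    L.le (γ t) y := by
  rcases ht.2.eq_or_lt with rfl | h₀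
  · rw [h.target]; exact L.le_refl y
  · simpa [h.target] using h.causal t ht 1 (by simp) h₀

theorem continuousOn (h : L.IsMaximisingGeodesic U γ x y) :
    ContinuousOn γ (Set.Icc 0 1) :=
  h.lipschitz.choose_spec.continuousOn

/-- The partition `0 < t < 1` bounds the length from above; the reverse triangle inequality gives
the other direction. -/
theorem ell_add_ell (h : L.IsMaximisingGeodesic U γ x y) (hfin : L.ell x y ≠ ⊤) {t : ℝ}
    (ht : t ∈ Set.Icc (0 : ℝ) 1) : L.ell x (γ t) + L.ell (γ t) y = L.ell x y := by
  have hxy : L.le x y := by simpa [h.target] using h.le_source (t := 1) (by simp)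
  rcases ht.1.eq_or_lt with rfl | h₀
  · rw [h.source, ell_self_left hxy hfin, zero_add]
  rcases ht.2.eq_or_lt with rfl | h₁
  · rw [h.target, ell_self_right hxy hfin, add_zero]
  refine le_antisymm (L.reverse_triangle _ _ _ (h.le_source ht) (h.le_target ht)) ?_
  simpa [h.maximising, h.source, h.target] using L.length_le_add γ h₀ h₁

end IsMaximisingGeodesic

/-- Intermediate values are taken in `[0, ∞]`, so `ℓ(u,y) = ∞` is allowed; `ell_ne_top_of_ll` relies
on this. -/
theorem exists_ell_eq (hL : L.GloballyNonpositivelyCurved) {U : Set X} {γ : ℝ → X} {u x y : X}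
    (h : L.IsMaximisingGeodesic U γ x y) {r : ℝ≥0∞} (h₁ : L.ell u x ≤ r) (h₂ : r ≤ L.ell u y) :
    ∃ t ∈ Set.Icc (0 : ℝ) 1, L.ell u (γ t) = r := by
  have hc : ContinuousOn (fun t => L.ell u (γ t)) (Set.Icc 0 1) :=
    hL.continuousOn.comp (f := fun t => (u, γ t)) (continuousOn_const.prodMk h.continuousOn)
      (fun t _ => by simp)
  exact intermediate_value_Icc zero_le_one hc ⟨by simpa [h.source], by simpa [h.target]⟩

theorem exists_geodesic (hL : L.GloballyNonpositivelyCurved) {x y : X} (h : 0 < L.ell x y)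
    (hfin : L.ell x y ≠ ⊤) : ∃ γ, L.IsMaximisingGeodesic Set.univ γ x y :=
  IsNonposComparisonNeighbourhood.exists_geodesic hL x trivial y trivial
    ((L.ell_pos_iff x y).1 h) hfin.lt_top

/-- A point dividing the time separation of two chronologically related points as prescribed. -/
theorem exists_between (hL : L.GloballyNonpositivelyCurved) {x y : X} (h : 0 < L.ell x y)
    (hfin : L.ell x y ≠ ⊤) {r : ℝ≥0∞} (hr : r ≤ L.ell x y) :
    ∃ p, L.le x p ∧ L.le p y ∧ L.ell x p = L.ell x y - r ∧ L.ell p y = r := by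
  obtain ⟨γ, hγ⟩ := exists_geodesic hL h hfin
  have hxy : L.le x y := L.le_of_ll _ _ ((L.ell_pos_iff x y).1 h)
  obtain ⟨t, ht, htr⟩ := exists_ell_eq hL hγ (u := x) (r := L.ell x y - r)
    (by simp [ell_self_left hxy hfin]) tsub_le_self
  refine ⟨γ t, hγ.le_source ht, hγ.le_target ht, htr, ?_⟩
  have h₁ := hγ.ell_add_ell hfin ht
  have h₂ := tsub_add_cancel_of_le hr
  rw [← h₂, ← htr] at h₁
  have h₃ : L.ell x (γ t) ≠ ⊤ := by rw [htr]; exact ENNReal.sub_ne_top hfin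
  exact (ENNReal.add_right_inj h₃).1 h₁

/-! ### Triangle comparison and the chronological case -/

/-- Comparison along the common side of two triangles `x y z` and `x z w`. -/
theorem minkowskiEll_add_le_ell (hL : L.GloballyNonpositivelyCurved) {x y z w : X}
    (hxy : 0 < L.ell x y) (hyz : 0 < L.ell y z) (hzw : 0 < L.ell z w) (hxw : L.ell x w ≠ ⊤)
    {x' y' z' w' p' : ℝ × ℝ} (h₁ : L.IsComparisonTriangle x y z x' y' z')
    (h₂ : L.IsComparisonTriangle x z w x' z' w') (hp' : p' ∈ segment ℝ x' z')
    (hadd : minkowskiEll x' p' + minkowskiEll p' z' = minkowskiEll x' z')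
    (hyp : 0 < minkowskiEll y' p') (hpw : 0 < minkowskiEll p' w') :
    minkowskiEll y' p' + minkowskiEll p' w' ≤ L.ell y w := by
  have llxy := (L.ell_pos_iff x y).1 hxy
  have llyz := (L.ell_pos_iff y z).1 hyz
  have llzw := (L.ell_pos_iff z w).1 hzw
  have llxz := L.ll_trans _ _ _ llxy llyz
  have lexz := L.le_of_ll _ _ llxz
  have hxz : L.ell x z ≠ ⊤ :=
    ne_top_of_le_ne_top hxw (ell_le_left lexz (L.le_of_ll _ _ llzw))
  have hzw' : L.ell z w ≠ ⊤ :=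
    ne_top_of_le_ne_top hxw (ell_le_right lexz (L.le_of_ll _ _ llzw))
  have hxy' : L.ell x y ≠ ⊤ :=
    ne_top_of_le_ne_top hxz (ell_le_left (L.le_of_ll _ _ llxy) (L.le_of_ll _ _ llyz))
  have hyz' : L.ell y z ≠ ⊤ :=
    ne_top_of_le_ne_top hxz (ell_le_right (L.le_of_ll _ _ llxy) (L.le_of_ll _ _ llyz))
  have hxw0 := (L.ell_pos_iff x w).2 (L.ll_trans _ _ _ llxz llzw)
  obtain ⟨α, hα⟩ := exists_geodesic hL hxy hxy'
  obtain ⟨β, hβ⟩ := exists_geodesic hL hyz hyz'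
  obtain ⟨γ, hγ⟩ := exists_geodesic hL ((L.ell_pos_iff x z).2 llxz) hxz
  obtain ⟨δ, hδ⟩ := exists_geodesic hL hzw hzw'
  obtain ⟨ε, hε⟩ := exists_geodesic hL hxw0 hxw
  -- Both triangles use the same geodesic `γ` as a side, so one point `γ t` corresponds to `p'` in
  -- both.
  obtain ⟨t, ht, htp⟩ := exists_ell_eq hL hγ (u := x) (r := minkowskiEll x' p')
    (by simp [ell_self_left lexz hxz]) (by rw [← h₁.2.2, ← hadd]; exact le_self_add)
  have hpz : minkowskiEll p' z' = L.ell (γ t) z := by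
    have hfin : minkowskiEll x' p' ≠ ⊤ := by
      refine ne_top_of_le_ne_top hxz ?_
      rw [← h₁.2.2, ← hadd]; exact le_self_add
    refine (ENNReal.add_right_inj hfin).1 ?_
    rw [hadd, h₁.2.2, ← htp, hγ.ell_add_ell hxz ht]
  have hp : L.IsComparisonPoint γ x z x' z' (γ t) p' := ⟨⟨t, ht, rfl⟩, hp', htp.symm, hpz⟩
  have hy : L.IsComparisonPoint α x y x' y' y y' :=
    ⟨⟨1, by simp, hα.target⟩, right_mem_segment ℝ _ _, h₁.1, by
      rw [minkowskiEll_self, ell_self_right (L.le_of_ll _ _ llxy) hxy']⟩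
  have hw : L.IsComparisonPoint δ z w z' w' w w' :=
    ⟨⟨1, by simp, hδ.target⟩, right_mem_segment ℝ _ _, h₂.2.1, by
      rw [minkowskiEll_self, ell_self_right (L.le_of_ll _ _ llzw) hzw']⟩
  have c₁ : minkowskiEll y' p' ≤ L.ell y (γ t) :=
    IsNonposComparisonNeighbourhood.comparison hL x y z α β γ
      ⟨llxy, llyz, hxz.lt_top, hα, hβ, hγ⟩ x' y' z' h₁ y (γ t) y' p'
      (Or.inl hy) (Or.inr (Or.inr hp))
  have c₂ : minkowskiEll p' w' ≤ L.ell (γ t) w :=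
    IsNonposComparisonNeighbourhood.comparison hL x z w γ δ ε
      ⟨llxz, llzw, hxw.lt_top, hγ, hδ, hε⟩ x' z' w' h₂ (γ t) w p' w'
      (Or.inl hp) (Or.inr (Or.inl hw))
  -- Positivity of the planar separations supplies the causal relations `y ≤ γ t ≤ w`.
  exact (add_le_add c₁ c₂).trans (L.reverse_triangle _ _ _
    (L.le_of_ll _ _ ((L.ell_pos_iff _ _).1 (hyp.trans_le c₁)))
    (L.le_of_ll _ _ ((L.ell_pos_iff _ _).1 (hpw.trans_le c₂))))

/-- The Ptolemy inequality for a chronological chain with finite time separations. -/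
theorem ptolemy_of_ne_top (hL : L.GloballyNonpositivelyCurved) {x y z w : X}
    (hxy : 0 < L.ell x y) (hyz : 0 < L.ell y z) (hzw : 0 < L.ell z w) (hxw : L.ell x w ≠ ⊤) :
    L.ell x y * L.ell z w + L.ell x w * L.ell y z ≤ L.ell x z * L.ell y w := by
  have lexy := L.le_of_ll _ _ ((L.ell_pos_iff x y).1 hxy)
  have leyz := L.le_of_ll _ _ ((L.ell_pos_iff y z).1 hyz)
  have lezw := L.le_of_ll _ _ ((L.ell_pos_iff z w).1 hzw)
  have lexz := L.le_trans _ _ _ lexy leyz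
  have leyw := L.le_trans _ _ _ leyz lezw
  obtain ⟨d, hd⟩ : ∃ d : ℝ, L.ell x w = ENNReal.ofReal d :=
    ⟨_, (ENNReal.ofReal_toReal hxw).symm⟩
  have hxz : L.ell x z ≠ ⊤ := ne_top_of_le_ne_top hxw (ell_le_left lexz lezw)
  have hyw : L.ell y w ≠ ⊤ := ne_top_of_le_ne_top hxw (ell_le_right lexy leyw)
  obtain ⟨a, ha, ea⟩ : ∃ a : ℝ, 0 < a ∧ L.ell x y = ENNReal.ofReal a :=
    have h := ne_top_of_le_ne_top hxz (ell_le_left lexy leyz)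
    ⟨_, ENNReal.toReal_pos hxy.ne' h, (ENNReal.ofReal_toReal h).symm⟩
  obtain ⟨b, hb, eb⟩ : ∃ b : ℝ, 0 < b ∧ L.ell y z = ENNReal.ofReal b :=
    have h := ne_top_of_le_ne_top hxz (ell_le_right lexy leyz)
    ⟨_, ENNReal.toReal_pos hyz.ne' h, (ENNReal.ofReal_toReal h).symm⟩
  obtain ⟨c, hc, ec⟩ : ∃ c : ℝ, 0 < c ∧ L.ell z w = ENNReal.ofReal c :=
    have h := ne_top_of_le_ne_top hyw (ell_le_right leyz lezw)
    ⟨_, ENNReal.toReal_pos hzw.ne' h, (ENNReal.ofReal_toReal h).symm⟩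
  obtain ⟨e, he, ee⟩ : ∃ e : ℝ, 0 < e ∧ L.ell x z = ENNReal.ofReal e :=
    ⟨_, ENNReal.toReal_pos (hxy.trans_le (ell_le_left lexy leyz)).ne' hxz,
      (ENNReal.ofReal_toReal hxz).symm⟩
  obtain ⟨f, hf, ef⟩ : ∃ f : ℝ, 0 < f ∧ L.ell y w = ENNReal.ofReal f :=
    ⟨_, ENNReal.toReal_pos (hyz.trans_le (ell_le_left leyz lezw)).ne' hyw,
      (ENNReal.ofReal_toReal hyw).symm⟩
  have hd0 : 0 < d := by
    rw [← ENNReal.ofReal_pos, ← hd]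
    exact hyz.trans_le ((ell_le_left leyz lezw).trans (ell_le_right lexy leyw))
  have tri {r s t : ℝ} (hr : 0 < r) (hs : 0 < s) (ht : 0 < t)
      (h : ENNReal.ofReal r + ENNReal.ofReal s ≤ ENNReal.ofReal t) : r + s ≤ t := by
    rwa [← ENNReal.ofReal_add hr.le hs.le, ENNReal.ofReal_le_ofReal_iff ht.le] at h
  have habe : a + b ≤ e := tri ha hb he (by
    rw [← ea, ← eb, ← ee]; exact L.reverse_triangle _ _ _ lexy leyz)
  have hbcf : b + c ≤ f := tri hb hc hf (by
    rw [← eb, ← ec, ← ef]; exact L.reverse_triangle _ _ _ leyz lezw)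
  have hecd : e + c ≤ d := tri he hc hd0 (by
    rw [← ee, ← ec, ← hd]; exact L.reverse_triangle _ _ _ lexz lezw)
  suffices h : a * c + d * b ≤ e * f by
    rw [ea, eb, ec, hd, ee, ef, ← ENNReal.ofReal_mul ha.le, ← ENNReal.ofReal_mul hd0.le,
      ← ENNReal.ofReal_mul he.le, ← ENNReal.ofReal_add (by positivity) (by positivity)]
    exact ENNReal.ofReal_le_ofReal h
  -- Since `2e(e-Y) = e² + b² - a²` and `2e(W-e) = d² - e² - c²`, this comparison decides convexity
  -- at `z'`; equality is Stewart's relation for collinear `y'`, `z'`, `w'`.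
  rcases le_total (b * d ^ 2 + c * a ^ 2) ((b + c) * (e ^ 2 + b * c)) with hst | hst
  · exact ptolemy_of_stewart hb hc he hbcf (by linarith) hst
  obtain ⟨Y, m, hm, haY, hbY, h₁, h₂⟩ := exists_apex_between ha hb habe
  obtain ⟨W, n, hn, hdW, hcW, h₄, h₃⟩ := exists_apex_beyond he hc hecd
  have hmY : m < Y := lt_of_sq_eq_sub ha (by linarith) h₁
  have hme : m < e - Y := lt_of_sq_eq_sub hb (by linarith) h₂
  have hnw : n < W - e := lt_of_sq_eq_sub hc (by linarith) h₃
  refine ptolemy_of_broken_lines ha hb hc he hm hn haY hbY hcW h₁ h₂ h₃ h₄ ?_ ?_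
  · refine le_of_mul_le_mul_left ?_ (show 0 < 2 * e by positivity)
    linear_combination hst + c * h₁ - c * h₂ - b * h₃ + b * h₄
  intro P hP₀ hP₁ hmP
  have m₁ : minkowskiEll (0, 0) (e, 0) = ENNReal.ofReal e :=
    minkowskiEll_of_abs_le he.le (by simpa using he.le) (by ring)
  have m₂ : minkowskiEll (0, 0) (Y, -m) = ENNReal.ofReal a :=
    minkowskiEll_of_abs_le ha.le (by simpa [abs_of_nonneg hm] using hmY.le) (by linarith)
  have m₃ : minkowskiEll (Y, -m) (e, 0) = ENNReal.ofReal b :=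
    minkowskiEll_of_abs_le hb.le (by simpa [abs_of_nonneg hm] using hme.le) (by linarith)
  have m₄ : minkowskiEll (e, 0) (W, n) = ENNReal.ofReal c :=
    minkowskiEll_of_abs_le hc.le (by simpa [abs_of_nonneg hn] using hnw.le) (by linarith)
  have m₅ : minkowskiEll (0, 0) (W, n) = ENNReal.ofReal d :=
    minkowskiEll_of_abs_le hd0.le (by simp only [sub_zero, abs_of_nonneg hn]; linarith)
      (by linarith)
  have m₆ : minkowskiEll (0, 0) (P, 0) = ENNReal.ofReal P :=
    minkowskiEll_of_abs_le hP₀ (by simpa using hP₀) (by ring)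
  have m₇ : minkowskiEll (P, 0) (e, 0) = ENNReal.ofReal (e - P) :=
    minkowskiEll_of_abs_le (sub_nonneg.2 hP₁) (by simpa using hP₁) (by ring)
  have q₁ : 0 < (P - Y) ^ 2 - m ^ 2 := sub_pos.2 (pow_lt_pow_left₀ hmP hm two_ne_zero)
  have q₂ : 0 < (W - P) ^ 2 - n ^ 2 :=
    sub_pos.2 (pow_lt_pow_left₀ (by linarith) hn two_ne_zero)
  have m₈ : minkowskiEll (Y, -m) (P, 0) = ENNReal.ofReal √((P - Y) ^ 2 - m ^ 2) :=
    minkowskiEll_of_abs_le (Real.sqrt_nonneg _)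
      (by simpa [abs_of_nonneg hm] using hmP.le) (by rw [Real.sq_sqrt q₁.le]; ring)
  have m₉ : minkowskiEll (P, 0) (W, n) = ENNReal.ofReal √((W - P) ^ 2 - n ^ 2) :=
    minkowskiEll_of_abs_le (Real.sqrt_nonneg _)
      (by simp only [sub_zero, abs_of_nonneg hn]; linarith)
      (by rw [Real.sq_sqrt q₂.le]; ring)
  have key := minkowskiEll_add_le_ell hL hxy hyz hzw hxw (x' := (0, 0)) (y' := (Y, -m))
    (z' := (e, 0)) (w' := (W, n)) (p' := (P, 0))
    ⟨m₂.trans ea.symm, m₃.trans eb.symm, m₁.trans ee.symm⟩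
    ⟨m₁.trans ee.symm, m₄.trans ec.symm, m₅.trans hd.symm⟩ ?_ ?_ ?_ ?_
  · rw [m₈, m₉, ef] at key
    exact tri (Real.sqrt_pos.2 q₁) (Real.sqrt_pos.2 q₂) hf key
  · refine ⟨1 - P / e, P / e, ?_, by positivity, by ring, ?_⟩
    · rw [sub_nonneg, div_le_one he]; exact hP₁
    · ext
      · simp [he.ne']
      · simp
  · rw [m₁, m₆, m₇, ← ENNReal.ofReal_add hP₀ (sub_nonneg.2 hP₁)]
    congr 1; ring
  · rw [m₈]; exact ENNReal.ofReal_pos.2 (Real.sqrt_pos.2 q₁)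
  · rw [m₉]; exact ENNReal.ofReal_pos.2 (Real.sqrt_pos.2 q₂)

/-! ### Causal ends and infinite separations -/

/-- Two points dividing the interval between `y` and `z`, close to `y` and `z` respectively. -/
theorem exists_between_between (hL : L.GloballyNonpositivelyCurved) {y z : X}
    (hfin : L.ell y z ≠ ⊤) {r : ℝ≥0∞} (h₀ : 0 < r) (hr : r < L.ell y z) :
    ∃ p q, L.le y p ∧ L.le p q ∧ L.le q z ∧ 0 < L.ell y p ∧ L.ell p q = r ∧ 0 < L.ell q z := by
  obtain ⟨s, hrs, hs⟩ := _root_.exists_between hr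
  obtain ⟨p, hyp, hpz, h₁, h₂⟩ := exists_between hL (h₀.trans hr) hfin hs.le
  have hs' : L.ell p z ≠ ⊤ := by rw [h₂]; exact ne_top_of_lt hs
  obtain ⟨q, hpq, hqz, h₃, h₄⟩ := exists_between hL (x := p) (y := z) (r := s - r)
    (by rw [h₂]; exact h₀.trans hrs) hs' (by rw [h₂]; exact tsub_le_self)
  refine ⟨p, q, hyp, hpq, hqz, ?_, ?_, ?_⟩
  · rw [h₁]; exact tsub_pos_of_lt hs
  · rw [h₃, h₂]; exact ENNReal.sub_sub_cancel (ne_top_of_lt hs) hrs.le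
  · rw [h₄]; exact tsub_pos_of_lt hrs

/-- Points `p ≪ q` strictly between `y` and `z` satisfy `x ≪ p` and `q ≪ w`, so the chronological
case applies; `ℓ(p,q)` can be any positive value below `ℓ(y,z)`. -/
theorem ell_mul_ell_le_of_ne_top (hL : L.GloballyNonpositivelyCurved) {x y z w : X}
    (hxy : L.le x y) (hyz : L.le y z) (hzw : L.le z w) (hxw : L.ell x w ≠ ⊤) :
    L.ell x w * L.ell y z ≤ L.ell x z * L.ell y w := by
  refine ENNReal.mul_le_of_forall_lt fun r' hr' r hr => ?_
  rcases eq_or_ne r 0 with rfl | h0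
  · simp
  have hfin : L.ell y z ≠ ⊤ := ne_top_of_le_ne_top hxw
    ((ell_le_left hyz hzw).trans (ell_le_right hxy (L.le_trans _ _ _ hyz hzw)))
  obtain ⟨p, q, hyp, hpq, hqz, h₁, rfl, h₃⟩ :=
    exists_between_between hL hfin (pos_iff_ne_zero.2 h0) hr
  have hxp := L.le_trans _ _ _ hxy hyp
  have hqw := L.le_trans _ _ _ hqz hzw
  have key := ptolemy_of_ne_top hL (x := x) (y := p) (z := q) (w := w)
    (h₁.trans_le (ell_le_right hxy hyp)) (pos_iff_ne_zero.2 h0)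
    (h₃.trans_le (ell_le_left hqz hzw)) hxw
  calc r' * L.ell p q ≤ L.ell x w * L.ell p q := by gcongr
    _ ≤ L.ell x q * L.ell p w := le_add_self.trans key
    _ ≤ L.ell x z * L.ell y w := mul_le_mul'
      (ell_le_left (L.le_trans _ _ _ hxp hpq) hqz)
      (ell_le_right hyp (L.le_trans _ _ _ hpq hqw))

/-- Were `ℓ(x,w)` infinite, `ℓ(x,·)` would take arbitrarily large finite values on a geodesic from
`z` to `w`, against the bound `ℓ(x,·) ℓ(y,z) ≤ ℓ(x,z) ℓ(y,w)`. -/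
theorem ell_ne_top_of_ll (hL : L.GloballyNonpositivelyCurved) {x y z w : X}
    (hxy : L.le x y) (hyz : 0 < L.ell y z) (hzw : 0 < L.ell z w)
    (hxz : L.ell x z ≠ ⊤) (hyw : L.ell y w ≠ ⊤) : L.ell x w ≠ ⊤ := by
  intro hxw
  have leyz := L.le_of_ll _ _ ((L.ell_pos_iff y z).1 hyz)
  have lezw := L.le_of_ll _ _ ((L.ell_pos_iff z w).1 hzw)
  obtain ⟨γ, hγ⟩ := exists_geodesic hL hzw (ne_top_of_le_ne_top hyw (ell_le_right leyz lezw))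
  obtain ⟨n, hn⟩ := ENNReal.exists_nat_mul_gt hyz.ne' (ENNReal.mul_ne_top hxz hyw)
  obtain ⟨t, ht, htr⟩ := exists_ell_eq hL hγ (u := x) (r := max n (L.ell x z))
    (le_max_right _ _) (by simp [hxw])
  have hzt := hγ.le_source ht
  have key := ell_mul_ell_le_of_ne_top hL hxy leyz hzt
    (by rw [htr]; exact (max_lt (ENNReal.natCast_lt_top n) hxz.lt_top).ne)
  refine hn.not_ge ?_
  calc n * L.ell y z ≤ L.ell x (γ t) * L.ell y z := by rw [htr]; gcongr; exact le_max_left _ _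
    _ ≤ _ := key
    _ ≤ _ := mul_le_mul' le_rfl
      (ell_le_left (L.le_trans _ _ _ leyz hzt) (hγ.le_target ht))

/-- Replacing `z` by a point `q ≪ z` with `y ≪ q` makes the last relation chronological. -/
theorem ell_ne_top (hL : L.GloballyNonpositivelyCurved) {x y z w : X}
    (hxy : L.le x y) (hyz : 0 < L.ell y z) (hzw : L.le z w)
    (hxz : L.ell x z ≠ ⊤) (hyw : L.ell y w ≠ ⊤) : L.ell x w ≠ ⊤ := by
  have leyz := L.le_of_ll _ _ ((L.ell_pos_iff y z).1 hyz)
  obtain ⟨r, h₀, hr⟩ := _root_.exists_between hyz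
  obtain ⟨p, q, hyp, hpq, hqz, -, rfl, h₃⟩ := exists_between_between hL
    (ne_top_of_le_ne_top hyw (ell_le_left leyz hzw)) h₀ hr
  have hyq := L.le_trans _ _ _ hyp hpq
  exact ell_ne_top_of_ll hL hxy (h₀.trans_le (ell_le_right hyp hpq))
    (h₃.trans_le (ell_le_left hqz hzw))
    (ne_top_of_le_ne_top hxz (ell_le_left (L.le_trans _ _ _ hxy hyq) hqz)) hyw

theorem isPtolemaic (hL : L.GloballyNonpositivelyCurved) : L.IsPtolemaic := by
  intro x y z w hxy hyz hzw
  rcases eq_or_ne (L.ell y z) 0 with h0 | h0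
  · rw [h0, mul_zero, add_zero]
    exact mul_le_mul' (ell_le_left hxy hyz) (ell_le_right hyz hzw)
  have hpos := pos_iff_ne_zero.2 h0
  -- Nonvanishing is needed because `0 * ⊤ = 0`: an infinite factor on the right then makes the
  -- product infinite.
  have hxz0 : L.ell x z ≠ 0 := (hpos.trans_le (ell_le_right hxy hyz)).ne'
  have hyw0 : L.ell y w ≠ 0 := (hpos.trans_le (ell_le_left hyz hzw)).ne'
  by_cases h₁ : L.ell x z = ⊤
  · simp [h₁, ENNReal.top_mul hyw0]
  by_cases h₂ : L.ell y w = ⊤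
  · simp [h₂, ENNReal.mul_top hxz0]
  have h₃ := ell_ne_top hL hxy hpos hzw h₁ h₂
  by_cases h₄ : 0 < L.ell x y ∧ 0 < L.ell z w
  · exact ptolemy_of_ne_top hL h₄.1 hpos h₄.2 h₃
  · have : L.ell x y * L.ell z w = 0 := by
      rw [mul_eq_zero]
      contrapose! h₄
      exact ⟨pos_iff_ne_zero.2 h₄.1, pos_iff_ne_zero.2 h₄.2⟩
    rw [this, zero_add]
    exact ell_mul_ell_le_of_ne_top hL hxy hyz hzw h₃

end LorentzianPreLengthSpace

theorem proposition4p1 {X : Type*} [MetricSpace X] (L : LorentzianPreLengthSpace X)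
    (hL : L.GloballyNonpositivelyCurved) : L.IsPtolemaic :=
  LorentzianPreLengthSpace.isPtolemaic hL
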